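/- Let $\mathbb H$ be the quaternions, $n\in\mathbb N$, and let $D\subset\mathbb C^n$ be an open set invariant under each partial conjugation $z\mapsto\overline z^{\,h}:=(z_1,\dots,z_{h-1},\overline{z_h},z_{h+1},\dots,z_n)$, $h=1,\dots,n$. A stem function on $D$ is a map $F=\sum_{K\subset\{1,\dots,n\}}e_KF_K:D\to\mathbb H\otimes\mathbb R^{2^n}$, with components $F_K:D\to\mathbb H$ along the basis $(e_K)_K$ of $\mathbb R^{2^n}$, such that $F_K(\overline z^{\,h})=(-1)^{|K\cap\{h\}|}F_K(z)$ for all $K$, $h$ and $z\in D$. Writing $z_h=\alpha_h+i\beta_h$, it is holomorphic if it is of class $C^1$ and $$\tfrac12\Big(\frac{\partial F}{\partial\alpha_h}+\mathcal J_h\frac{\partial F}{\partial\beta_h}\Big)=0\quad\text{on }D\text{ for every }h=1,\dots,n,$$ where $\mathcal J_h$ is the real linear map of $\mathbb H\otimes\mathbb R^{2^n}$ with $\mathcal J_h(q\otimes e_K)=(-1)^{|K\cap\{h\}|}q\otimes e_{K\triangle\{h\}}$. Let $$\Omega_D:=\{(\alpha_1+J_1\beta_1,\dots,\alpha_n+J_n\beta_n)\;:\;(\alpha_1+i\beta_1,\dots,\alpha_n+i\beta_n)\in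 D,\ J_h\in\mathbb H,\ J_h^2=-1\}\subset\mathbb H^n .$$ A function $f:\Omega_D\to\mathbb H$ is slice regular if there is a holomorphic stem function $F$ on $D$ such that $$f(\alpha_1+J_1\beta_1,\dots,\alpha_n+J_n\beta_n)=\sum_{K=\{k_1<\dots<k_p\}}J_{k_1}\cdots J_{k_p}\,F_K(\alpha_1+i\beta_1,\dots,\alpha_n+i\beta_n)$$ for all $(\alpha_1+i\beta_1,\dots,\alpha_n+i\beta_n)\in D$ and all $J_1,\dots,J_n\in\mathbb H$ with $J_h^2=-1$. Then every slice regular function $f:\Omega_D\to\mathbb H$ is separately biharmonic in each variable: for every $m\in\{1,\dots,n\}$, $f$ is of class $C^4$ as a function of the single variable $x_m$ (the others being fixed), and $$\Delta_m^2f=\Delta_m(\Delta_mf)=0\quad\text{on }\Omega_D,$$ where $\Delta_m$ is the Laplacian of $\mathbb H\cong\mathbb R^4$ in the variable $x_m$. -/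

import Mathlib

open scoped Quaternion symmDiff

noncomputable section

namespace SliceSeveral

/-- The partial conjugate of `z ∈ ℂⁿ`: the coordinate `z h` is replaced by its conjugate. -/
def conjAt {n : ℕ} (h : Fin n) (z : Fin n → ℂ) : Fin n → ℂ :=
  Function.update z h (starRingEnd ℂ (z h))

/-- Invariance of `D ⊆ ℂⁿ` under every partial conjugation. -/
def IsConjInvariant {n : ℕ} (D : Set (Fin n → ℂ)) : Prop :=
  ∀ (z : Fin n → ℂ) (h : Fin n), z ∈ D ↔ conjAt h z ∈ D

/-- The space `ℍ ⊗ ℝ^(2ⁿ)`: an element `∑_K e_K v_K` is the family of its components `v_K ∈ ℍ`,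
indexed by the subsets `K` of the set of indices. -/
abbrev StemSpace (n : ℕ) : Type := Finset (Fin n) → ℍ[ℝ]

/-- `F = ∑_K e_K F_K : D → ℍ ⊗ ℝ^(2ⁿ)` is a stem function. Only the values of `F` on `D`
matter. -/
def IsStem {n : ℕ} (D : Set (Fin n → ℂ)) (F : (Fin n → ℂ) → StemSpace n) : Prop :=
  IsConjInvariant D ∧
    ∀ z ∈ D, ∀ (K : Finset (Fin n)) (h : Fin n),
      F (conjAt h z) K = (-1 : ℝ) ^ (K ∩ {h}).card • F z K

/-- The complex structure `𝒥_h` of `ℍ ⊗ ℝ^(2ⁿ)`, that is the real linear map with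
`𝒥_h (q ⊗ e_K) = (-1)^|K ∩ {h}| q ⊗ e_(K ∆ {h})`, written in components: the `L`-th component of
the image comes from `K = L ∆ {h}`. -/
def complexStructure {n : ℕ} (h : Fin n) (v : StemSpace n) : StemSpace n :=
  fun L => (-1 : ℝ) ^ ((L ∆ {h}) ∩ {h}).card • v (L ∆ {h})

/-- The operator `½ (∂/∂α_h + 𝒥_h ∂/∂β_h)`, where `z_h = α_h + i β_h`. -/
def stemDbar {n : ℕ} (h : Fin n) (F : (Fin n → ℂ) → StemSpace n) (z : Fin n → ℂ) : StemSpace n :=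
  (1 / 2 : ℝ) • (fderiv ℝ F z (Pi.single h 1) +
    complexStructure h (fderiv ℝ F z (Pi.single h Complex.I)))

/-- Holomorphy, on an open set `D`, of a stem function. -/
def IsHolomorphicStem {n : ℕ} (D : Set (Fin n → ℂ)) (F : (Fin n → ℂ) → StemSpace n) : Prop :=
  IsStem D F ∧ ContDiffOn ℝ 1 F D ∧ ∀ h : Fin n, ∀ z ∈ D, stemDbar h F z = 0

/-- The quaternionic point `(α_1 + J_1 β_1, …, α_n + J_n β_n)`, where `z_h = α_h + i β_h`. -/
def slicePoint {n : ℕ} (J : Fin n → ℍ[ℝ]) (z : Fin n → ℂ) : Fin n → ℍ[ℝ] :=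
  fun h => ((z h).re : ℍ[ℝ]) + J h * ((z h).im : ℍ[ℝ])

/-- `J` is a tuple of quaternionic imaginary units. -/
def IsUnitTuple {n : ℕ} (J : Fin n → ℍ[ℝ]) : Prop := ∀ h : Fin n, J h ^ 2 = -1

/-- The circularization `Ω_D ⊆ ℍⁿ` of `D ⊆ ℂⁿ`. -/
def circularization {n : ℕ} (D : Set (Fin n → ℂ)) : Set (Fin n → ℍ[ℝ]) :=
  {x | ∃ z ∈ D, ∃ J : Fin n → ℍ[ℝ], IsUnitTuple J ∧ x = slicePoint J z}

/-- The product `J_K = J_(k_1) ⋯ J_(k_p)` over `K = {k_1 < ⋯ < k_p}`, in increasing order of the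
indices; it is `1` for empty `K`. -/
def orderedProd {n : ℕ} (J : Fin n → ℍ[ℝ]) (K : Finset (Fin n)) : ℍ[ℝ] :=
  (List.ofFn fun h : Fin n => if h ∈ K then J h else 1).prod

/-- On `Ω_D`, `f` is the slice function induced by `F`. -/
def IsInducedBy {n : ℕ} (D : Set (Fin n → ℂ)) (F : (Fin n → ℂ) → StemSpace n)
    (f : (Fin n → ℍ[ℝ]) → ℍ[ℝ]) : Prop :=
  ∀ z ∈ D, ∀ J : Fin n → ℍ[ℝ], IsUnitTuple J →
    f (slicePoint J z) = ∑ K : Finset (Fin n), orderedProd J K * F z K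

/-- `f` is slice regular on `Ω_D`, for `D` open. Only the values of `f` on `Ω_D` matter. -/
def IsSliceRegular {n : ℕ} (D : Set (Fin n → ℂ)) (f : (Fin n → ℍ[ℝ]) → ℍ[ℝ]) : Prop :=
  ∃ F : (Fin n → ℂ) → StemSpace n, IsHolomorphicStem D F ∧ IsInducedBy D F f

/-- The Laplacian `Δ_m` of `ℍ ≅ ℝ⁴` with respect to the `m`-th quaternionic variable. -/
def partialLaplacian {n : ℕ} (m : Fin n) (f : (Fin n → ℍ[ℝ]) → ℍ[ℝ]) : (Fin n → ℍ[ℝ]) → ℍ[ℝ] :=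
  fun x => Laplacian.laplacian (fun q : ℍ[ℝ] => f (Function.update x m q)) (x m)

/-- `f` is separately biharmonic in each variable on the open set `Ω`: it is of class `C⁴` in each
single variable, and `Δ_m (Δ_m f) = 0` on `Ω` for every `m`. -/
def IsSeparatelyBiharmonicOn {n : ℕ} (f : (Fin n → ℍ[ℝ]) → ℍ[ℝ]) (Ω : Set (Fin n → ℍ[ℝ])) :
    Prop :=
  ∀ m : Fin n, ∀ x ∈ Ω,
    ContDiffAt ℝ 4 (fun q : ℍ[ℝ] => f (Function.update x m q)) (x m) ∧
      partialLaplacian m (partialLaplacian m f) x = 0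

end SliceSeveral

end

/-! Freeze every variable except `x_m = q = α + aβ`, with `a` an imaginary unit. For `m ∉ K` the
ordered products over `K` and `K ∪ {m}` are `A B` and `A a B`, where `A`, `B` do not involve `a`.
Expanding `F_K` and `F_(K ∪ {m})` along `1, i, j, k` makes `f` a finite sum of terms `A (u + a v) B
e_i`. Each `φ = u + i v` (`stemSlice`) is holomorphic in `z_m`, by the equation for `𝒥_m`, and
commutes with conjugation, by the parity of `F`. Such a term is a real linear image of `sliceLift
φ`, so one quaternionic variable suffices.

Off the real axis put `β = ‖q.im‖` and `axial q = α + iβ`. The gradients of `α` and `β` are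
orthonormal and `Δβ = 2/β`, whence `Δ(χ ∘ axial) = 2i χ'/β` for holomorphic `χ`, while `χ/β` is
harmonic (`laplacian_inv_norm_im_mul_comp_axial`). Thus `Re φ` is biharmonic. The other part of
`sliceLift φ` is a sum of terms coordinate times harmonic function, again biharmonic. At real points
`sliceLift φ` is a power series in `q` with real coefficients (`analyticAt_sliceLift_coe`), so its
bilaplacian is continuous there and vanishes as a limit (`biharmonicAt_sliceLift`). -/

noncomputable section

open scoped Topology
open Filter Laplacian

namespace SliceSeveral

/-! ### Directional derivatives of analytic maps. -/

section DirectionalDerivative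

variable {E F : Type*} [NormedAddCommGroup E] [NormedSpace ℝ E]
  [NormedAddCommGroup F] [NormedSpace ℝ F]

/-- The derivative of `f` in the direction `e`. -/
def dirDeriv (e : E) (f : E → F) (x : E) : F := fderiv ℝ f x e

lemma dirDeriv_congr {e : E} {f g : E → F} {x : E} (h : f =ᶠ[𝓝 x] g) :
    dirDeriv e f =ᶠ[𝓝 x] dirDeriv e g := by
  filter_upwards [h.eventuallyEq_nhds] with y hy
  simp [dirDeriv, hy.fderiv_eq]

lemma analyticAt_dirDeriv [CompleteSpace F] {e : E} {f : E → F} {x : E} (h : AnalyticAt ℝ f x) :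
    AnalyticAt ℝ (dirDeriv e f) x :=
  ((ContinuousLinearMap.apply ℝ F e).analyticAt _).comp h.fderiv

lemma dirDeriv_dirDeriv [CompleteSpace F] {d e : E} {f : E → F} {x : E} (h : AnalyticAt ℝ f x) :
    dirDeriv d (dirDeriv e f) x = fderiv ℝ (fderiv ℝ f) x d e := by
  have := h.fderiv.differentiableAt
  unfold dirDeriv
  rw [fderiv_clm_apply this (differentiableAt_const e)]
  simp

lemma dirDeriv_comm [CompleteSpace F] {d e : E} {f : E → F} {x : E} (h : AnalyticAt ℝ f x) :
    dirDeriv d (dirDeriv e f) x = dirDeriv e (dirDeriv d f) x := by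
  rw [dirDeriv_dirDeriv h, dirDeriv_dirDeriv h]
  exact (h.contDiffAt (n := 2)).isSymmSndFDerivAt (by simp) d e

lemma dirDeriv_mul {e : E} {f g : E → ℂ} {x : E} (hf : DifferentiableAt ℝ f x)
    (hg : DifferentiableAt ℝ g x) :
    dirDeriv e (f * g) x = f x * dirDeriv e g x + dirDeriv e f x * g x := by
  simp [dirDeriv, fderiv_mul hf hg]
  ring

lemma dirDeriv_holomorphic_comp {e : E} {χ : ℂ → ℂ} {w : E → ℂ} {x : E}
    (hχ : DifferentiableAt ℂ χ (w x)) (hw : DifferentiableAt ℝ w x) :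
    dirDeriv e (χ ∘ w) x = deriv χ (w x) * dirDeriv e w x := by
  have h := (hχ.hasDerivAt.hasFDerivAt.restrictScalars ℝ).comp x hw.hasFDerivAt
  simp [dirDeriv, h.fderiv, mul_comm]

end DirectionalDerivative

/-! ### Product and chain rules for the Laplacian. -/

section Laplacian

variable {E F ι : Type*} [NormedAddCommGroup E] [InnerProductSpace ℝ E] [FiniteDimensional ℝ E]
  [Fintype ι] [NormedAddCommGroup F] [NormedSpace ℝ F] [CompleteSpace F]

lemma laplacian_eq_sum_dirDeriv (b : OrthonormalBasis ι ℝ E) {f : E → F} {x : E}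
    (h : AnalyticAt ℝ f x) : Δ f x = ∑ i, dirDeriv (b i) (dirDeriv (b i) f) x := by
  rw [InnerProductSpace.laplacian_eq_iteratedFDeriv_orthonormalBasis f b]
  simp [iteratedFDeriv_two_apply, dirDeriv_dirDeriv h]

lemma laplacian_eventuallyEq_sum_dirDeriv (b : OrthonormalBasis ι ℝ E) {f : E → F} {x : E}
    (h : AnalyticAt ℝ f x) :
    Δ f =ᶠ[𝓝 x] fun y => ∑ i, dirDeriv (b i) (dirDeriv (b i) f) y := by
  filter_upwards [h.eventually_analyticAt] with y hy using laplacian_eq_sum_dirDeriv b hy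

lemma analyticAt_laplacian {f : E → F} {x : E} (h : AnalyticAt ℝ f x) :
    AnalyticAt ℝ (Δ f) x := by
  have b := stdOrthonormalBasis ℝ E
  refine AnalyticAt.congr ?_ (laplacian_eventuallyEq_sum_dirDeriv b h).symm
  exact Finset.analyticAt_fun_sum _ fun i _ => analyticAt_dirDeriv (analyticAt_dirDeriv h)

lemma laplacian_dirDeriv {f : E → F} {x e : E} (h : AnalyticAt ℝ f x) :
    Δ (dirDeriv e f) x = dirDeriv e (Δ f) x := by
  let b := stdOrthonormalBasis ℝ E
  rw [laplacian_eq_sum_dirDeriv b (analyticAt_dirDeriv h),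
    (dirDeriv_congr (laplacian_eventuallyEq_sum_dirDeriv b h)).self_of_nhds]
  have : dirDeriv e (fun y => ∑ i, dirDeriv (b i) (dirDeriv (b i) f) y) x =
      ∑ i, dirDeriv e (dirDeriv (b i) (dirDeriv (b i) f)) x := by
    rw [dirDeriv, fderiv_fun_sum fun i _ =>
      (analyticAt_dirDeriv (e := b i) (analyticAt_dirDeriv (e := b i) h)).differentiableAt]
    simp [dirDeriv]
  rw [this]
  refine Finset.sum_congr rfl fun i _ => ?_
  rw [dirDeriv_comm (analyticAt_dirDeriv h) (d := e)]
  refine (dirDeriv_congr ?_).self_of_nhds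
  filter_upwards [h.eventually_analyticAt] with y hy using dirDeriv_comm hy

lemma laplacian_mul (b : OrthonormalBasis ι ℝ E) {f g : E → ℂ} {x : E} (hf : AnalyticAt ℝ f x)
    (hg : AnalyticAt ℝ g x) :
    Δ (f * g) x = Δ f x * g x + 2 * ∑ i, dirDeriv (b i) f x * dirDeriv (b i) g x
      + f x * Δ g x := by
  rw [laplacian_eq_sum_dirDeriv b (hf.mul hg), laplacian_eq_sum_dirDeriv b hf,
    laplacian_eq_sum_dirDeriv b hg, Finset.sum_mul, Finset.mul_sum, Finset.mul_sum,
    ← Finset.sum_add_distrib, ← Finset.sum_add_distrib]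
  refine Finset.sum_congr rfl fun i _ => ?_
  have h : dirDeriv (b i) (f * g) =ᶠ[𝓝 x] f * dirDeriv (b i) g + dirDeriv (b i) f * g := by
    filter_upwards [hf.eventually_analyticAt, hg.eventually_analyticAt] with y hy hy'
    simpa using dirDeriv_mul hy.differentiableAt hy'.differentiableAt
  have df := hf.differentiableAt
  have dg := hg.differentiableAt
  have ddf := (analyticAt_dirDeriv (e := b i) hf).differentiableAt
  have ddg := (analyticAt_dirDeriv (e := b i) hg).differentiableAt
  have hadd : dirDeriv (b i) (f * dirDeriv (b i) g + dirDeriv (b i) f * g) x =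
      dirDeriv (b i) (f * dirDeriv (b i) g) x + dirDeriv (b i) (dirDeriv (b i) f * g) x := by
    simp only [dirDeriv] at ddf ddg ⊢
    rw [fderiv_add (df.mul ddg) (ddf.mul dg)]
    rfl
  rw [(dirDeriv_congr h).self_of_nhds, hadd, dirDeriv_mul df ddg, dirDeriv_mul ddf dg]
  ring

/-- Since `deriv χ` acts complex linearly, the second-order term involves the complex sum of squares
of the `∂_i w`, not of their moduli. For `w = axial` this sum vanishes. -/
lemma laplacian_holomorphic_comp (b : OrthonormalBasis ι ℝ E) {χ : ℂ → ℂ} {w : E → ℂ} {x : E}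
    (hχ : AnalyticAt ℂ χ (w x)) (hw : AnalyticAt ℝ w x) :
    Δ (χ ∘ w) x = deriv (deriv χ) (w x) * ∑ i, dirDeriv (b i) w x ^ 2
      + deriv χ (w x) * Δ w x := by
  have hχ' : AnalyticAt ℝ χ (w x) := hχ.restrictScalars
  rw [laplacian_eq_sum_dirDeriv b (hχ'.comp hw), laplacian_eq_sum_dirDeriv b hw,
    Finset.mul_sum, Finset.mul_sum, ← Finset.sum_add_distrib]
  refine Finset.sum_congr rfl fun i _ => ?_
  have h : dirDeriv (b i) (χ ∘ w) =ᶠ[𝓝 x] (deriv χ ∘ w) * dirDeriv (b i) w := by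
    filter_upwards [hw.eventually_analyticAt,
      hw.continuousAt.eventually hχ.eventually_analyticAt] with y hy hy'
    exact dirDeriv_holomorphic_comp hy'.differentiableAt hy.differentiableAt
  rw [(dirDeriv_congr h).self_of_nhds, dirDeriv_mul
    ((hχ.deriv.restrictScalars (𝕜 := ℝ)).comp hw).differentiableAt
    (analyticAt_dirDeriv hw).differentiableAt,
    dirDeriv_holomorphic_comp hχ.deriv.differentiableAt hw.differentiableAt]
  simp only [Function.comp_apply]
  ring

end Laplacian

/-! ### Coordinates on `ℍ` and analyticity of `axial`. -/

/-- The orthonormal basis `1, i, j, k` of the quaternions. -/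
def quaternionBasis : OrthonormalBasis (Fin 4) ℝ ℍ[ℝ] :=
  OrthonormalBasis.ofRepr Quaternion.linearIsometryEquivTuple

lemma quaternionBasis_re (i : Fin 4) :
    (quaternionBasis i).re = (Pi.single i 1 : Fin 4 → ℝ) 0 :=
  congrArg (fun v : EuclideanSpace ℝ (Fin 4) => v 0) (quaternionBasis.repr_self i)

lemma quaternionBasis_imI (i : Fin 4) :
    (quaternionBasis i).imI = (Pi.single i 1 : Fin 4 → ℝ) 1 :=
  congrArg (fun v : EuclideanSpace ℝ (Fin 4) => v 1) (quaternionBasis.repr_self i)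

lemma quaternionBasis_imJ (i : Fin 4) :
    (quaternionBasis i).imJ = (Pi.single i 1 : Fin 4 → ℝ) 2 :=
  congrArg (fun v : EuclideanSpace ℝ (Fin 4) => v 2) (quaternionBasis.repr_self i)

lemma quaternionBasis_imK (i : Fin 4) :
    (quaternionBasis i).imK = (Pi.single i 1 : Fin 4 → ℝ) 3 :=
  congrArg (fun v : EuclideanSpace ℝ (Fin 4) => v 3) (quaternionBasis.repr_self i)

lemma norm_im_eq_sqrt (q : ℍ[ℝ]) : ‖q.im‖ = √(q.imI ^ 2 + q.imJ ^ 2 + q.imK ^ 2) := by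
  rw [norm_eq_sqrt_real_inner, Quaternion.inner_self, Quaternion.normSq_def']
  simp

/-- The coordinate along `quaternionBasis i`. -/
def coordCLM (i : Fin 4) : ℍ[ℝ] →L[ℝ] ℝ := innerSL ℝ (quaternionBasis i)

lemma coordCLM_zero_apply (q : ℍ[ℝ]) : coordCLM 0 q = q.re := by
  rw [coordCLM, innerSL_apply_apply, Quaternion.inner_def, Quaternion.re_mul]
  simp [quaternionBasis_re, quaternionBasis_imI, quaternionBasis_imJ, quaternionBasis_imK]

lemma coordCLM_one_apply (q : ℍ[ℝ]) : coordCLM 1 q = q.imI := by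
  rw [coordCLM, innerSL_apply_apply, Quaternion.inner_def, Quaternion.re_mul]
  simp [quaternionBasis_re, quaternionBasis_imI, quaternionBasis_imJ, quaternionBasis_imK]

lemma coordCLM_two_apply (q : ℍ[ℝ]) : coordCLM 2 q = q.imJ := by
  rw [coordCLM, innerSL_apply_apply, Quaternion.inner_def, Quaternion.re_mul]
  simp [quaternionBasis_re, quaternionBasis_imI, quaternionBasis_imJ, quaternionBasis_imK]

lemma coordCLM_three_apply (q : ℍ[ℝ]) : coordCLM 3 q = q.imK := by
  rw [coordCLM, innerSL_apply_apply, Quaternion.inner_def, Quaternion.re_mul]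
  simp [quaternionBasis_re, quaternionBasis_imI, quaternionBasis_imJ, quaternionBasis_imK]

lemma coordCLM_quaternionBasis (i j : Fin 4) :
    coordCLM j (quaternionBasis i) = if j = i then 1 else 0 := by
  simp [coordCLM, innerSL_apply_apply, quaternionBasis.inner_eq_ite]

/-- The point `α + i β` of the closed upper half plane with `q = α + J β` for an imaginary
unit `J`. -/
def axial (q : ℍ[ℝ]) : ℂ := ⟨q.re, ‖q.im‖⟩

/-- The `i`-th coordinate of the imaginary part of a quaternion. -/
def imCoord (i : Fin 4) (q : ℍ[ℝ]) : ℝ := if i = 0 then 0 else coordCLM i q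

lemma sum_imCoord_sq (q : ℍ[ℝ]) : ∑ i, imCoord i q ^ 2 = ‖q.im‖ ^ 2 := by
  rw [norm_im_eq_sqrt, Real.sq_sqrt (by positivity)]
  simp [Fin.sum_univ_four, imCoord, coordCLM_one_apply, coordCLM_two_apply, coordCLM_three_apply]

lemma continuous_axial : Continuous axial := by
  have : axial = fun q => ((q.re : ℝ) : ℂ) + ((‖q.im‖ : ℝ) : ℂ) * Complex.I := by
    ext q; simp [axial, Complex.ext_iff]
  rw [this]
  have := Quaternion.continuous_re
  have := Quaternion.continuous_im
  fun_prop

lemma analyticAt_norm_im {q : ℍ[ℝ]} (hq : q.im ≠ 0) :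
    AnalyticAt ℝ (fun y : ℍ[ℝ] => ‖y.im‖) q := by
  have h : (fun y : ℍ[ℝ] => ‖y.im‖) =
      fun y => √(coordCLM 1 y ^ 2 + coordCLM 2 y ^ 2 + coordCLM 3 y ^ 2) := by
    ext y
    rw [norm_im_eq_sqrt, coordCLM_one_apply, coordCLM_two_apply, coordCLM_three_apply]
  rw [h]
  have hpos : 0 < coordCLM 1 q ^ 2 + coordCLM 2 q ^ 2 + coordCLM 3 q ^ 2 := by
    have := norm_pos_iff.2 hq
    rw [norm_im_eq_sqrt, Real.sqrt_pos] at this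
    rwa [coordCLM_one_apply, coordCLM_two_apply, coordCLM_three_apply]
  have hc (i : Fin 4) : AnalyticAt ℝ (coordCLM i) q := (coordCLM i).analyticAt q
  refine AnalyticAt.fun_comp (g := Real.sqrt) ?_
    ((((hc 1).pow 2).add ((hc 2).pow 2)).add ((hc 3).pow 2))
  exact (Real.contDiffAt_sqrt hpos.ne').analyticAt

lemma analyticAt_axial {q : ℍ[ℝ]} (hq : q.im ≠ 0) : AnalyticAt ℝ axial q := by
  have : axial = fun q => Complex.ofRealCLM (coordCLM 0 q) +
      Complex.ofRealCLM ‖q.im‖ * Complex.I := by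
    ext q; simp [axial, Complex.ext_iff, coordCLM_zero_apply]
  rw [this]
  refine AnalyticAt.add ?_ (AnalyticAt.mul ?_ analyticAt_const)
  · exact (Complex.ofRealCLM.analyticAt _).fun_comp ((coordCLM 0).analyticAt q)
  · exact (Complex.ofRealCLM.analyticAt _).fun_comp (analyticAt_norm_im hq)

lemma analyticAt_inv_norm_im {q : ℍ[ℝ]} (hq : q.im ≠ 0) :
    AnalyticAt ℝ (fun y : ℍ[ℝ] => ((‖y.im‖⁻¹ : ℝ) : ℂ)) q :=
  (Complex.ofRealCLM.analyticAt _).fun_comp ((analyticAt_norm_im hq).inv (norm_ne_zero_iff.2 hq))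

lemma eventually_im_ne_zero {q : ℍ[ℝ]} (hq : q.im ≠ 0) : ∀ᶠ y : ℍ[ℝ] in 𝓝 q, y.im ≠ 0 :=
  Quaternion.continuous_im.continuousAt.eventually_ne hq

/-- Once analyticity gives differentiability, partial derivatives reduce to one-variable calculus
along coordinate lines. -/
lemma dirDeriv_eq_of_hasDerivAt {F : Type*} [NormedAddCommGroup F] [NormedSpace ℝ F]
    {f : ℍ[ℝ] → F} {q e : ℍ[ℝ]} {c : F} (hf : DifferentiableAt ℝ f q)
    (h : HasDerivAt (fun s : ℝ => f (q + s • e)) c 0) : dirDeriv e f q = c := by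
  have h' : HasLineDerivAt ℝ f c q e := h
  rw [dirDeriv, ← hf.lineDeriv_eq_fderiv, h'.lineDeriv]

/-! ### First and second derivatives of `β`, `1/β` and `axial`. -/

lemma hasDerivAt_coord (i j : Fin 4) (q : ℍ[ℝ]) :
    HasDerivAt (fun s : ℝ => coordCLM j (q + s • quaternionBasis i)) (if j = i then 1 else 0) 0 := by
  have := ((hasDerivAt_id (0 : ℝ)).mul_const (if j = i then (1 : ℝ) else 0)).const_add (coordCLM j q)
  simpa [coordCLM_quaternionBasis] using this

lemma hasDerivAt_imCoord (i : Fin 4) (q : ℍ[ℝ]) :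
    HasDerivAt (fun s : ℝ => imCoord i (q + s • quaternionBasis i)) (if i = 0 then 0 else 1) 0 := by
  by_cases hi : i = 0
  · simpa [imCoord, hi] using hasDerivAt_const (0 : ℝ) (0 : ℝ)
  · simpa [imCoord, hi] using hasDerivAt_coord i i q

lemma hasDerivAt_norm_im (i : Fin 4) {q : ℍ[ℝ]} (hq : q.im ≠ 0) :
    HasDerivAt (fun s : ℝ => ‖(q + s • quaternionBasis i).im‖) (imCoord i q * ‖q.im‖⁻¹) 0 := by
  have h (y : ℍ[ℝ]) : ‖y.im‖ = √(coordCLM 1 y ^ 2 + coordCLM 2 y ^ 2 + coordCLM 3 y ^ 2) := by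
    rw [norm_im_eq_sqrt, coordCLM_one_apply, coordCLM_two_apply, coordCLM_three_apply]
  have hpos : √(coordCLM 1 q ^ 2 + coordCLM 2 q ^ 2 + coordCLM 3 q ^ 2) ≠ 0 := by
    rw [← h]; exact norm_ne_zero_iff.2 hq
  have hne : coordCLM 1 q ^ 2 + coordCLM 2 q ^ 2 + coordCLM 3 q ^ 2 ≠ 0 := by
    intro h0; simp [h0] at hpos
  simp only [h]
  have := ((((hasDerivAt_coord i 1 q).fun_pow 2).add ((hasDerivAt_coord i 2 q).fun_pow 2)).add
    ((hasDerivAt_coord i 3 q).fun_pow 2)).sqrt (by simpa using hne)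
  convert this using 1
  simp only [Pi.add_apply]
  fin_cases i <;> simp [imCoord] <;> field_simp

lemma hasDerivAt_inv_norm_im (i : Fin 4) {q : ℍ[ℝ]} (hq : q.im ≠ 0) :
    HasDerivAt (fun s : ℝ => ‖(q + s • quaternionBasis i).im‖⁻¹)
      (-imCoord i q * ‖q.im‖⁻¹ ^ 3) 0 := by
  have := (hasDerivAt_norm_im i hq).fun_inv (by simpa using hq)
  refine this.congr_deriv ?_
  have : ‖q.im‖ ≠ 0 := norm_ne_zero_iff.2 hq
  simp only [zero_smul, add_zero]
  field_simp

lemma dirDeriv_axial (i : Fin 4) {q : ℍ[ℝ]} (hq : q.im ≠ 0) :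
    dirDeriv (quaternionBasis i) axial q =
      (if i = 0 then 1 else 0) + ((imCoord i q * ‖q.im‖⁻¹ : ℝ) : ℂ) * Complex.I := by
  refine dirDeriv_eq_of_hasDerivAt (analyticAt_axial hq).differentiableAt ?_
  have := (hasDerivAt_coord i 0 q).ofReal_comp.add
    ((hasDerivAt_norm_im i hq).ofReal_comp.mul_const Complex.I)
  convert this using 1
  · ext s; simp [axial, Complex.ext_iff, coordCLM_zero_apply]
  · by_cases hi : i = 0 <;> simp [hi, eq_comm]

lemma dirDeriv_dirDeriv_axial (i : Fin 4) {q : ℍ[ℝ]} (hq : q.im ≠ 0) :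
    dirDeriv (quaternionBasis i) (dirDeriv (quaternionBasis i) axial) q =
      (((if i = 0 then 0 else 1) * ‖q.im‖⁻¹ - imCoord i q ^ 2 * ‖q.im‖⁻¹ ^ 3 : ℝ) : ℂ)
        * Complex.I := by
  have hev : ∀ᶠ s : ℝ in 𝓝 0, (q + s • quaternionBasis i).im ≠ 0 := by
    have hc : ContinuousAt (fun s : ℝ => q + s • quaternionBasis i) 0 := by fun_prop
    exact hc.eventually (by simpa using eventually_im_ne_zero hq)
  refine dirDeriv_eq_of_hasDerivAt
    (analyticAt_dirDeriv (analyticAt_axial hq)).differentiableAt ?_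
  have := (((hasDerivAt_imCoord i q).fun_mul
    (hasDerivAt_inv_norm_im i hq)).ofReal_comp.mul_const Complex.I).const_add
    (if i = 0 then (1 : ℂ) else 0)
  refine (this.congr_of_eventuallyEq ?_).congr_deriv ?_
  · filter_upwards [hev] with s hs using dirDeriv_axial i hs
  · congr 2; simp; ring

/-- `α` is harmonic, and `β` is the radius in the three-dimensional imaginary space, so `Δβ = (3 -
1)/β`. -/
lemma laplacian_axial {q : ℍ[ℝ]} (hq : q.im ≠ 0) :
    Δ axial q = 2 * ((‖q.im‖⁻¹ : ℝ) : ℂ) * Complex.I := by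
  have h0 : ‖q.im‖ ≠ 0 := norm_ne_zero_iff.2 hq
  rw [laplacian_eq_sum_dirDeriv quaternionBasis (analyticAt_axial hq)]
  simp only [dirDeriv_dirDeriv_axial _ hq]
  rw [← Finset.sum_mul, ← Complex.ofReal_sum, Finset.sum_sub_distrib, ← Finset.sum_mul,
    ← Finset.sum_mul, sum_imCoord_sq]
  congr 1
  rw [← Complex.ofReal_ofNat, ← Complex.ofReal_mul]
  congr 1
  simp [Fin.sum_univ_four]
  field_simp
  norm_num

/-- The sum is `|∇α|² - |∇β|² + 2i ∇α·∇β`, with `∇α`, `∇β` orthonormal. -/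
lemma sum_dirDeriv_axial_sq {q : ℍ[ℝ]} (hq : q.im ≠ 0) :
    ∑ i, dirDeriv (quaternionBasis i) axial q ^ 2 = 0 := by
  have h0 : (‖q.im‖ : ℂ) ≠ 0 := by simpa using hq
  have h := congrArg (fun r : ℝ => (r : ℂ)) (sum_imCoord_sq q)
  simp only [dirDeriv_axial _ hq]
  simp [Fin.sum_univ_four, imCoord] at h ⊢
  have hI := Complex.I_sq
  field_simp
  linear_combination (norm := ring_nf) h * Complex.I ^ 2 + ‖q.im‖ ^ 2 * hI

lemma dirDeriv_inv_norm_im (i : Fin 4) {q : ℍ[ℝ]} (hq : q.im ≠ 0) :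
    dirDeriv (quaternionBasis i) (fun y : ℍ[ℝ] => ((‖y.im‖⁻¹ : ℝ) : ℂ)) q =
      ((-imCoord i q * ‖q.im‖⁻¹ ^ 3 : ℝ) : ℂ) :=
  dirDeriv_eq_of_hasDerivAt (analyticAt_inv_norm_im hq).differentiableAt
    (hasDerivAt_inv_norm_im i hq).ofReal_comp

/-- `1/β` is the Newtonian potential of the imaginary space `ℝ³`: the three directions give `-3β⁻³ +
3β²β⁻⁵`. -/
lemma laplacian_inv_norm_im {q : ℍ[ℝ]} (hq : q.im ≠ 0) :
    Δ (fun y : ℍ[ℝ] => ((‖y.im‖⁻¹ : ℝ) : ℂ)) q = 0 := by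
  have h0 : ‖q.im‖ ≠ 0 := norm_ne_zero_iff.2 hq
  have key (i : Fin 4) : dirDeriv (quaternionBasis i) (dirDeriv (quaternionBasis i)
      (fun y : ℍ[ℝ] => ((‖y.im‖⁻¹ : ℝ) : ℂ))) q =
      ((-(if i = 0 then 0 else 1) * ‖q.im‖⁻¹ ^ 3 + 3 * imCoord i q ^ 2 * ‖q.im‖⁻¹ ^ 5 : ℝ) : ℂ) := by
    have hev : ∀ᶠ s : ℝ in 𝓝 0, (q + s • quaternionBasis i).im ≠ 0 := by
      have hc : ContinuousAt (fun s : ℝ => q + s • quaternionBasis i) 0 := by fun_prop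
      exact hc.eventually (by simpa using eventually_im_ne_zero hq)
    refine dirDeriv_eq_of_hasDerivAt
      (analyticAt_dirDeriv (analyticAt_inv_norm_im hq)).differentiableAt ?_
    have := ((hasDerivAt_imCoord i q).fun_neg.fun_mul
      ((hasDerivAt_inv_norm_im i hq).fun_pow 3)).ofReal_comp
    refine (this.congr_of_eventuallyEq ?_).congr_deriv ?_
    · filter_upwards [hev] with s hs using dirDeriv_inv_norm_im i hs
    · congr 1; simp; ring
  rw [laplacian_eq_sum_dirDeriv quaternionBasis (analyticAt_inv_norm_im hq)]
  simp only [key]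
  rw [← Complex.ofReal_sum, Finset.sum_add_distrib, ← Finset.sum_mul, ← Finset.sum_mul,
    ← Finset.mul_sum, sum_imCoord_sq, Complex.ofReal_eq_zero]
  simp [Fin.sum_univ_four]
  field_simp
  norm_num

/-- `∇(1/β) = -β⁻²∇β` is orthogonal to `∇α`, so only the term with `i∇β` survives. -/
lemma sum_dirDeriv_inv_norm_im_mul_dirDeriv_axial {q : ℍ[ℝ]} (hq : q.im ≠ 0) :
    ∑ i, dirDeriv (quaternionBasis i) (fun y : ℍ[ℝ] => ((‖y.im‖⁻¹ : ℝ) : ℂ)) q *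
      dirDeriv (quaternionBasis i) axial q = -((‖q.im‖⁻¹ : ℝ) : ℂ) ^ 2 * Complex.I := by
  have h0 : (‖q.im‖ : ℂ) ≠ 0 := by simpa using hq
  have h := congrArg (fun r : ℝ => (r : ℂ)) (sum_imCoord_sq q)
  simp only [dirDeriv_axial _ hq, dirDeriv_inv_norm_im _ hq]
  simp [Fin.sum_univ_four, imCoord] at h ⊢
  field_simp
  linear_combination (norm := ring_nf) -h

/-! ### Harmonicity and biharmonicity off the real axis. -/

/-- A holomorphic function of `α + i β`, divided by `β`, is harmonic off the real axis. -/
lemma laplacian_inv_norm_im_mul_comp_axial {χ : ℂ → ℂ} {q : ℍ[ℝ]} (hq : q.im ≠ 0)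
    (hχ : AnalyticAt ℂ χ (axial q)) :
    Δ ((fun y : ℍ[ℝ] => ((‖y.im‖⁻¹ : ℝ) : ℂ)) * (χ ∘ axial)) q = 0 := by
  have ha : AnalyticAt ℝ χ (axial q) := hχ.restrictScalars
  have hd (i : Fin 4) : dirDeriv (quaternionBasis i) (χ ∘ axial) q =
      deriv χ (axial q) * dirDeriv (quaternionBasis i) axial q :=
    dirDeriv_holomorphic_comp hχ.differentiableAt (analyticAt_axial hq).differentiableAt
  have hs := sum_dirDeriv_inv_norm_im_mul_dirDeriv_axial hq
  rw [laplacian_mul quaternionBasis (analyticAt_inv_norm_im hq) (ha.comp (analyticAt_axial hq)),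
    laplacian_inv_norm_im hq, laplacian_holomorphic_comp quaternionBasis hχ (analyticAt_axial hq),
    sum_dirDeriv_axial_sq hq, laplacian_axial hq]
  -- The cross term `-2iβ⁻²χ'` cancels `β⁻¹ · 2iβ⁻¹χ'`, which comes from `Δ(χ ∘ axial)`.
  simp only [hd, mul_left_comm _ (deriv χ (axial q)), ← Finset.mul_sum, hs]
  ring

lemma laplacian_laplacian_comp_axial {χ : ℂ → ℂ} {q : ℍ[ℝ]} (hq : q.im ≠ 0)
    (hχ : AnalyticAt ℂ χ (axial q)) : Δ (Δ (χ ∘ axial)) q = 0 := by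
  -- `Δ(χ ∘ axial)` is `β⁻¹` times this holomorphic function of `axial`, hence harmonic.
  let χ' : ℂ → ℂ := fun w => 2 * Complex.I * deriv χ w
  have h : Δ (χ ∘ axial) =ᶠ[𝓝 q] (fun y : ℍ[ℝ] => ((‖y.im‖⁻¹ : ℝ) : ℂ)) * (χ' ∘ axial) := by
    filter_upwards [eventually_im_ne_zero hq,
      continuous_axial.continuousAt.eventually hχ.eventually_analyticAt] with y hy hy'
    rw [laplacian_holomorphic_comp quaternionBasis hy' (analyticAt_axial hy),
      sum_dirDeriv_axial_sq hy, laplacian_axial hy]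
    simp [χ']
    ring
  rw [(InnerProductSpace.laplacian_congr_nhds h).self_of_nhds]
  exact laplacian_inv_norm_im_mul_comp_axial hq (analyticAt_const.mul hχ.deriv)

/-- The product of a coordinate and a harmonic function is biharmonic. -/
lemma laplacian_laplacian_coord_mul {k : ℍ[ℝ] → ℂ} {q : ℍ[ℝ]} (i : Fin 4)
    (hk : AnalyticAt ℝ k q) (h : Δ k =ᶠ[𝓝 q] 0) :
    Δ (Δ ((fun y => ((coordCLM i y : ℝ) : ℂ)) * k)) q = 0 := by
  have hc (y : ℍ[ℝ]) : AnalyticAt ℝ (fun y => ((coordCLM i y : ℝ) : ℂ)) y :=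
    (Complex.ofRealCLM.comp (coordCLM i)).analyticAt y
  have hd (j : Fin 4) : dirDeriv (quaternionBasis j) (fun y => ((coordCLM i y : ℝ) : ℂ)) =
      fun _ => if i = j then 1 else 0 := by
    ext1 y
    refine dirDeriv_eq_of_hasDerivAt (hc y).differentiableAt ?_
    refine (hasDerivAt_coord j i y).ofReal_comp.congr_deriv ?_
    split_ifs <;> simp
  have hl (y : ℍ[ℝ]) : Δ (fun y => ((coordCLM i y : ℝ) : ℂ)) y = 0 := by
    rw [laplacian_eq_sum_dirDeriv quaternionBasis (hc y)]
    simp only [hd]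
    simp [dirDeriv]
  -- A coordinate is harmonic with constant gradient, so only the cross term `2 ∂_i k` remains. It
  -- is harmonic because `Δ` commutes with `∂_i`.
  have h1 : Δ ((fun y => ((coordCLM i y : ℝ) : ℂ)) * k) =ᶠ[𝓝 q]
      (2 : ℝ) • dirDeriv (quaternionBasis i) k := by
    filter_upwards [h, hk.eventually_analyticAt] with y hy hy'
    rw [laplacian_mul quaternionBasis (hc y) hy', hl, hy]
    simp [hd]
  rw [(InnerProductSpace.laplacian_congr_nhds h1).self_of_nhds,
    InnerProductSpace.laplacian_smul _ (analyticAt_dirDeriv hk).contDiffAt,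
    laplacian_dirDeriv hk, (dirDeriv_congr h).self_of_nhds]
  simp [dirDeriv]

/-! ### Stability of biharmonicity under sums and real linear maps. -/

/-- Real analyticity at a point together with the vanishing of the bilaplacian there. -/
def BiharmonicAt {F : Type*} [NormedAddCommGroup F] [NormedSpace ℝ F] (f : ℍ[ℝ] → F)
    (q : ℍ[ℝ]) : Prop :=
  AnalyticAt ℝ f q ∧ Δ (Δ f) q = 0

namespace BiharmonicAt

variable {F G : Type*} [NormedAddCommGroup F] [NormedSpace ℝ F] [NormedAddCommGroup G]
  [NormedSpace ℝ G] {f g : ℍ[ℝ] → F} {q : ℍ[ℝ]}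

lemma congr (hf : BiharmonicAt f q) (h : f =ᶠ[𝓝 q] g) : BiharmonicAt g q := by
  refine ⟨hf.1.congr h, ?_⟩
  rw [← hf.2]
  exact (InnerProductSpace.laplacian_congr_nhds
    (InnerProductSpace.laplacian_congr_nhds h.symm)).self_of_nhds

lemma zero : BiharmonicAt (0 : ℍ[ℝ] → F) q := by
  refine ⟨analyticAt_const, ?_⟩
  have h : Δ (0 : ℍ[ℝ] → F) = 0 := InnerProductSpace.laplacian_const (c := (0 : F))
  rw [h, h]; rfl

variable [CompleteSpace F]

lemma add (hf : BiharmonicAt f q) (hg : BiharmonicAt g q) : BiharmonicAt (f + g) q := by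
  refine ⟨hf.1.add hg.1, ?_⟩
  rw [(InnerProductSpace.laplacian_congr_nhds
    (hf.1.contDiffAt.laplacian_add_nhds hg.1.contDiffAt)).self_of_nhds]
  have := (analyticAt_laplacian hf.1).contDiffAt.laplacian_add
    (analyticAt_laplacian hg.1).contDiffAt
  rw [hf.2, hg.2, add_zero] at this
  exact this

lemma clm_comp (L : F →L[ℝ] G) (hf : BiharmonicAt f q) : BiharmonicAt (L ∘ f) q := by
  refine ⟨(L.analyticAt _).comp hf.1, ?_⟩
  rw [(InnerProductSpace.laplacian_congr_nhds
    (hf.1.contDiffAt.laplacian_CLM_comp_left_nhds (l := L))).self_of_nhds,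
    (analyticAt_laplacian hf.1).contDiffAt.laplacian_CLM_comp_left]
  simp [hf.2]

lemma sum {κ : Type*} (s : Finset κ) {f : κ → ℍ[ℝ] → F} (h : ∀ i ∈ s, BiharmonicAt (f i) q) :
    BiharmonicAt (∑ i ∈ s, f i) q :=
  Finset.sum_induction f (BiharmonicAt · q) (fun _ _ => add) zero h

end BiharmonicAt

/-! ### Slice functions of one quaternionic variable. -/

/-- The quaternionic slice function of one variable `α + J β ↦ u + J v` induced by
`φ = u + i v`. -/
def sliceLift (φ : ℂ → ℂ) (q : ℍ[ℝ]) : ℍ[ℝ] :=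
  ((φ (axial q)).re : ℍ[ℝ]) + (‖q.im‖⁻¹ * (φ (axial q)).im) • q.im

/-- Expanding `q.im` in coordinates exhibits the two scalar types already treated: `φ ∘ axial`, and
a coordinate times `φ/β`. Each is followed by a real linear map into `ℍ`. -/
lemma sliceLift_eq_sum (φ : ℂ → ℂ) :
    sliceLift φ = Complex.reCLM.smulRight (1 : ℍ[ℝ]) ∘ (φ ∘ axial) +
      ∑ i : Fin 3, Complex.imCLM.smulRight (quaternionBasis i.succ) ∘
        ((fun y => ((coordCLM i.succ y : ℝ) : ℂ)) *
          ((fun y : ℍ[ℝ] => ((‖y.im‖⁻¹ : ℝ) : ℂ)) * (φ ∘ axial))) := by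
  have h1 (q : ℍ[ℝ]) : coordCLM (Fin.succ 0) q = q.imI := coordCLM_one_apply q
  have h2 (q : ℍ[ℝ]) : coordCLM (Fin.succ 1) q = q.imJ := coordCLM_two_apply q
  have h3 (q : ℍ[ℝ]) : coordCLM (Fin.succ 2) q = q.imK := coordCLM_three_apply q
  ext q <;> simp only [Fin.sum_univ_three, Pi.add_apply, Pi.mul_apply, Function.comp_apply,
      ContinuousLinearMap.smulRight_apply, Complex.reCLM_apply, Complex.imCLM_apply,
      Complex.im_ofReal_mul, h1, h2, h3, sliceLift] <;>
    simp [quaternionBasis_re, quaternionBasis_imI, quaternionBasis_imJ, quaternionBasis_imK] <;>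
    ring

lemma biharmonicAt_sliceLift_of_im_ne_zero {φ : ℂ → ℂ} {q : ℍ[ℝ]} (hq : q.im ≠ 0)
    (hφ : AnalyticAt ℂ φ (axial q)) : BiharmonicAt (sliceLift φ) q := by
  have ha : AnalyticAt ℝ φ (axial q) := hφ.restrictScalars
  have hk := (analyticAt_inv_norm_im hq).mul (ha.comp (analyticAt_axial hq))
  rw [sliceLift_eq_sum]
  refine BiharmonicAt.add (BiharmonicAt.clm_comp _ ⟨ha.comp (analyticAt_axial hq),
    laplacian_laplacian_comp_axial hq hφ⟩) (BiharmonicAt.sum _ fun i _ => ?_)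
  refine BiharmonicAt.clm_comp _ ⟨?_, laplacian_laplacian_coord_mul i.succ hk ?_⟩
  · exact ((Complex.ofRealCLM.comp (coordCLM i.succ)).analyticAt q).mul hk
  · filter_upwards [eventually_im_ne_zero hq,
      continuous_axial.continuousAt.eventually hφ.eventually_analyticAt] with y hy hy'
    exact laplacian_inv_norm_im_mul_comp_axial hy hy'

lemma im_mul_im (q : ℍ[ℝ]) : q.im * q.im = ((-(‖q.im‖ ^ 2) : ℝ) : ℍ[ℝ]) := by
  have h : -(‖q.im‖ ^ 2) = -(q.imI ^ 2 + q.imJ ^ 2 + q.imK ^ 2) := by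
    rw [norm_im_eq_sqrt, Real.sq_sqrt (by positivity)]
  generalize -(‖q.im‖ ^ 2) = r at h
  ext
  · simp only [Quaternion.re_mul, Quaternion.re_im, Quaternion.imI_im, Quaternion.imJ_im,
      Quaternion.imK_im, Quaternion.re_coe]
    linear_combination -h
  all_goals simp; try ring

lemma exists_imaginaryUnit (q : ℍ[ℝ]) :
    ∃ J : ℍ[ℝ], J ^ 2 = -1 ∧ q.im = J * (‖q.im‖ : ℍ[ℝ]) := by
  by_cases hq : q.im = 0
  -- For real `q` every imaginary unit works; `i` is taken.
  · refine ⟨quaternionBasis 1, ?_, by simp [hq]⟩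
    rw [sq]
    ext <;> simp [quaternionBasis_re, quaternionBasis_imI, quaternionBasis_imJ,
      quaternionBasis_imK]
  · have h0 : ‖q.im‖ ≠ 0 := norm_ne_zero_iff.2 hq
    refine ⟨‖q.im‖⁻¹ • q.im, ?_, ?_⟩
    · rw [sq, smul_mul_smul_comm, im_mul_im, ← Quaternion.coe_smul, smul_eq_mul]
      have : ‖q.im‖⁻¹ * ‖q.im‖⁻¹ * -‖q.im‖ ^ 2 = -1 := by field_simp
      rw [this]; simp
    · rw [← Quaternion.coe_commutes, Quaternion.coe_mul_eq_smul, smul_smul, mul_inv_cancel₀ h0,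
        one_smul]

/-- At real `q` the second term of `sliceLift` is zero while `J` is arbitrary, so the formula needs
`Im φ = 0` there. -/
lemma sliceLift_eq {φ : ℂ → ℂ} {q J : ℍ[ℝ]} (hJ : q.im = J * (‖q.im‖ : ℍ[ℝ]))
    (h : q.im = 0 → (φ (axial q)).im = 0) :
    sliceLift φ q = ((φ (axial q)).re : ℍ[ℝ]) + J * ((φ (axial q)).im : ℍ[ℝ]) := by
  rw [sliceLift]
  congr 1
  by_cases hq : q.im = 0
  · simp [h hq]
  · have h0 : ‖q.im‖ ≠ 0 := norm_ne_zero_iff.2 hq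
    have : (‖q.im‖⁻¹ * (φ (axial q)).im) • q.im =
        (‖q.im‖⁻¹ * (φ (axial q)).im) • (J * (‖q.im‖ : ℍ[ℝ])) := by rw [← hJ]
    rw [this, ← Quaternion.coe_commutes, ← Quaternion.coe_commutes, Quaternion.coe_mul_eq_smul,
      Quaternion.coe_mul_eq_smul, smul_smul]
    congr 1
    field_simp

/-! ### Analyticity and biharmonicity at real points. -/

lemma norm_axial (q : ℍ[ℝ]) : ‖axial q‖ = ‖q‖ := by
  have h1 : ‖axial q‖ ^ 2 = q.re ^ 2 + ‖q.im‖ ^ 2 := by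
    rw [← Complex.normSq_eq_norm_sq, Complex.normSq_apply]; simp [axial, sq]
  have h2 : ‖q‖ ^ 2 = q.re ^ 2 + ‖q.im‖ ^ 2 := by
    rw [norm_im_eq_sqrt, Real.sq_sqrt (by positivity), sq, ← Quaternion.normSq_eq_norm_mul_self,
      Quaternion.normSq_def']
    ring
  exact (sq_eq_sq₀ (norm_nonneg _) (norm_nonneg _)).1 (h1.trans h2.symm)

/-- Symmetry under conjugation allows real Taylor coefficients at `a`, and a real power series
commutes with every embedding `ℂ → ℍ`, `i ↦ J`. Hence the same coefficients expand `sliceLift φ` in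
powers of the quaternion, whatever the slice. -/
lemma analyticAt_sliceLift_coe {φ : ℂ → ℂ} {a : ℝ} (hφ : AnalyticAt ℂ φ a)
    (hsym : ∀ᶠ w in 𝓝 (a : ℂ), φ (starRingEnd ℂ w) = starRingEnd ℂ (φ w)) :
    AnalyticAt ℝ (sliceLift φ) (a : ℍ[ℝ]) := by
  obtain ⟨p, r, hp⟩ := hφ
  obtain ⟨ε, hε, hball⟩ := EMetric.mem_nhds_iff.1 hsym
  have hp' := hp.mono (lt_min hp.r_pos hε) (min_le_left r ε)
  -- On this radius the series converges and the symmetry holds.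
  set r' := min r ε
  let c : ℕ → ℝ := fun n => (p.coeff n).re
  have hsum (w : ℂ) (hw : ‖w‖ₑ < r') : HasSum (fun n => ((c n : ℝ) : ℂ) * w ^ n) (φ (a + w)) := by
    have h1 (w : ℂ) (hw : ‖w‖ₑ < r') : HasSum (fun n => p.coeff n * w ^ n) (φ (a + w)) := by
      have := hp'.hasSum (y := w) (by simpa [edist_zero_right] using hw)
      simpa [FormalMultilinearSeries.apply_eq_pow_smul_coeff, mul_comm] using this
    have hc : ‖starRingEnd ℂ w‖ₑ < r' := by simpa [enorm_eq_nnnorm] using hw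
    -- Conjugating the expansion at `conj w` gives a second expansion of the same value; averaging
    -- the two leaves the real parts of the coefficients.
    have h2 : HasSum (fun n => starRingEnd ℂ (p.coeff n) * w ^ n) (φ (a + w)) := by
      have := Complex.hasSum_conj'.2 (h1 _ hc)
      have hs : φ (starRingEnd ℂ (a + w)) = starRingEnd ℂ (φ (a + w)) := by
        refine hball ?_
        simpa [Metric.mem_eball, edist_eq_enorm_sub] using hw.trans_le (min_le_right _ _)
      rw [map_add, Complex.conj_ofReal] at hs
      simpa [hs] using this
    have h3 := ((h1 w hw).add h2).mul_left (1 / 2 : ℂ)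
    rw [← two_mul, one_div, inv_mul_cancel_left₀ two_ne_zero] at h3
    have hc' (n : ℕ) : ((c n : ℝ) : ℂ) * w ^ n =
        2⁻¹ * (p.coeff n * w ^ n + starRingEnd ℂ (p.coeff n) * w ^ n) := by
      rw [Complex.re_eq_add_conj]
      ring
    simpa only [hc'] using h3
  refine ⟨FormalMultilinearSeries.ofScalars ℍ[ℝ] c, r', ?_, hp'.r_pos, ?_⟩
  · refine le_trans hp'.r_le (ENNReal.le_of_forall_nnreal_lt fun s hs => ?_)
    obtain ⟨C, -, hC⟩ := p.norm_mul_pow_le_of_lt_radius hs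
    refine FormalMultilinearSeries.le_radius_of_bound _ C fun n => le_trans ?_ (hC n)
    gcongr
    rw [FormalMultilinearSeries.ofScalars_norm, FormalMultilinearSeries.norm_apply_eq_norm_coef]
    exact Complex.abs_re_le_norm _
  · intro y hy
    have hy' : ‖axial y‖ₑ < r' := by
      rw [Metric.mem_eball, edist_zero_right] at hy
      rwa [enorm_eq_nnnorm, show ‖axial y‖₊ = ‖y‖₊ from Subtype.ext (norm_axial y),
        ← enorm_eq_nnnorm]
    obtain ⟨J, hJ, hyJ⟩ := exists_imaginaryUnit y
    have hJ' : J * J = -1 := by rw [← sq, hJ]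
    -- The algebra embedding `i ↦ J` of `ℂ` onto the slice of `y`; it maps `axial y` to `y`, hence
    -- powers to powers.
    let ℓ := (Complex.liftAux J hJ').toLinearMap.toContinuousLinearMap
    have hℓ (w : ℂ) : ℓ w = (w.re : ℍ[ℝ]) + J * (w.im : ℍ[ℝ]) := by
      change Complex.liftAux J hJ' w = _
      rw [Complex.liftAux_apply, ← Quaternion.coe_commutes, Quaternion.coe_mul_eq_smul]
      rfl
    have hℓy : ℓ (axial y) = y := by
      rw [hℓ]
      change (y.re : ℍ[ℝ]) + J * (‖y.im‖ : ℍ[ℝ]) = y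
      rw [← hyJ, Quaternion.re_add_im]
    have hax : axial (a + y) = a + axial y := by
      simp [axial, Complex.ext_iff]
    have him : (a + y : ℍ[ℝ]).im = y.im := by simp
    have hval : sliceLift φ (a + y) = ℓ (φ (a + axial y)) := by
      rw [hℓ, ← hax]
      refine sliceLift_eq (by rw [him]; exact hyJ) fun h0 => ?_
      have hs : φ (starRingEnd ℂ (a + axial y)) = starRingEnd ℂ (φ (a + axial y)) := by
        refine hball ?_
        simpa [Metric.mem_eball, edist_eq_enorm_sub] using hy'.trans_le (min_le_right _ _)
      rw [← hax] at hs
      have hreal : starRingEnd ℂ (axial (a + y)) = axial (a + y) := by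
        simp [Complex.ext_iff, axial, h0]
      rw [hreal] at hs
      exact Complex.conj_eq_iff_im.1 hs.symm
    rw [hval]
    have := ℓ.hasSum (hsum _ hy')
    convert this using 1
    ext1 n
    rw [FormalMultilinearSeries.ofScalars_apply_eq, ← Complex.real_smul, map_smul]
    congr 1
    conv_lhs => rw [← hℓy]
    exact (map_pow (Complex.liftAux J hJ') (axial y) n).symm

lemma eq_coe_of_im_eq_zero {q : ℍ[ℝ]} (hq : q.im = 0) : q = (q.re : ℍ[ℝ]) := by
  conv_lhs => rw [← Quaternion.re_add_im q, hq, add_zero]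

/-- One-variable slice functions induced by holomorphic functions are biharmonic, including at
the real points. -/
theorem biharmonicAt_sliceLift {φ : ℂ → ℂ} {U : Set ℂ} (hU : IsOpen U)
    (hφ : DifferentiableOn ℂ φ U)
    (hsym : ∀ w ∈ U, φ (starRingEnd ℂ w) = starRingEnd ℂ (φ w)) {q : ℍ[ℝ]} (hq : axial q ∈ U) :
    BiharmonicAt (sliceLift φ) q := by
  have hφa (w : ℂ) (hw : w ∈ U) : AnalyticAt ℂ φ w := hφ.analyticAt (hU.mem_nhds hw)
  by_cases h0 : q.im = 0
  swap
  · exact biharmonicAt_sliceLift_of_im_ne_zero h0 (hφa _ hq)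
  have hax : axial q = (q.re : ℂ) := by simp [axial, h0, Complex.ext_iff]
  have ha : AnalyticAt ℝ (sliceLift φ) q := by
    rw [eq_coe_of_im_eq_zero h0]
    rw [hax] at hq
    refine analyticAt_sliceLift_coe (hφa _ hq) ?_
    filter_upwards [hU.mem_nhds hq] with w hw using hsym w hw
  refine ⟨ha, ?_⟩
  -- The line `q + t i` leaves the real axis for `t ≠ 0`, so the continuous bilaplacian vanishes
  -- along it and hence at `q`.
  have ht : Tendsto (fun t : ℝ => q + t • quaternionBasis 1) (𝓝[≠] 0) (𝓝 q) := by
    have hc : Continuous (fun t : ℝ => q + t • quaternionBasis 1) := by fun_prop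
    simpa using (hc.tendsto 0).mono_left nhdsWithin_le_nhds
  have h1 := (analyticAt_laplacian (analyticAt_laplacian ha)).continuousAt.tendsto.comp ht
  have h2 : (Δ (Δ (sliceLift φ)) ∘ fun t : ℝ => q + t • quaternionBasis 1) =ᶠ[𝓝[≠] 0]
      fun _ => 0 := by
    have hev := ht.eventually
      (continuous_axial.continuousAt.eventually (hU.mem_nhds hq))
    filter_upwards [hev, self_mem_nhdsWithin] with t htU ht0
    refine (biharmonicAt_sliceLift_of_im_ne_zero (fun him => ht0 ?_) (hφa _ htU)).2
    have := congrArg (fun y : ℍ[ℝ] => y.imI) him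
    have hqI := congrArg (fun y : ℍ[ℝ] => y.imI) h0
    simpa [quaternionBasis_imI, show q.imI = 0 from hqI] using this
  exact tendsto_nhds_unique h1 (tendsto_const_nhds.congr' h2.symm)

/-! ### Isolating the variable `x_m` in the stem function. -/

lemma prod_ofFn_update {M : Type*} [Monoid M] {n : ℕ} (c : Fin n → M) (m : Fin n) :
    ∃ A B : M, ∀ a, (List.ofFn (Function.update c m a)).prod = A * a * B := by
  refine ⟨((List.ofFn c).take m).prod, ((List.ofFn c).drop (m + 1)).prod, fun a => ?_⟩
  have h : List.ofFn (Function.update c m a) = (List.ofFn c).set m a := by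
    refine List.ext_getElem (by simp) fun i h1 h2 => ?_
    simp [Function.update_apply, List.getElem_set, Fin.ext_iff, eq_comm]
  rw [h, List.prod_set]
  simp

lemma exists_orderedProd_update {n : ℕ} (J : Fin n → ℍ[ℝ]) {m : Fin n} {K : Finset (Fin n)}
    (hm : m ∉ K) : ∃ A B : ℍ[ℝ], ∀ a, orderedProd (Function.update J m a) K = A * B ∧
      orderedProd (Function.update J m a) (insert m K) = A * a * B := by
  obtain ⟨A, B, h⟩ := prod_ofFn_update (fun h => if h ∈ K then J h else 1) m
  refine ⟨A, B, fun a => ⟨?_, ?_⟩⟩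
  · rw [← mul_one A, ← h 1, orderedProd]
    congr 2
    ext1 i
    by_cases hi : i = m
    · subst hi; simp [hm]
    · simp [hi]
  · rw [← h a, orderedProd]
    congr 2
    ext1 i
    by_cases hi : i = m
    · subst hi; simp
    · simp [hi]

/-- `𝒥_m` exchanges the components `K` and `K ∪ {m}`, with sign `-1` when passing from `K ∪ {m}` to
`K`. The equation therefore splits into Cauchy–Riemann systems for these pairs. -/
lemma cauchyRiemann_of_stemDbar_eq_zero {n : ℕ} {F : (Fin n → ℂ) → StemSpace n} {z : Fin n → ℂ}
    {m : Fin n} (h : stemDbar m F z = 0) {K : Finset (Fin n)} (hm : m ∉ K) :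
    fderiv ℝ F z (Pi.single m 1) K = fderiv ℝ F z (Pi.single m Complex.I) (insert m K) ∧
      fderiv ℝ F z (Pi.single m 1) (insert m K) = -fderiv ℝ F z (Pi.single m Complex.I) K := by
  have h' := (smul_eq_zero.1 h).resolve_left (by norm_num)
  have e1 : K ∆ {m} = insert m K := by
    ext i; by_cases hi : i = m <;> simp [Finset.mem_symmDiff, hi, hm]
  have e2 : insert m K ∆ {m} = K := by
    ext i; by_cases hi : i = m <;> simp [Finset.mem_symmDiff, hi, hm]
  have e3 : K ∩ {m} = ∅ := Finset.inter_singleton_of_notMem hm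
  have e4 : insert m K ∩ {m} = {m} := Finset.inter_singleton_of_mem (Finset.mem_insert_self m K)
  constructor
  · have := congrFun h' K
    simp only [Pi.add_apply, complexStructure, e1, e4] at this
    simpa [← sub_eq_add_neg, sub_eq_zero] using this
  · have := congrFun h' (insert m K)
    simp only [Pi.add_apply, complexStructure, e2, e3] at this
    simpa [add_eq_zero_iff_eq_neg] using this

/-- The complex-valued function of `z_m` whose real and imaginary parts are the `i`-th
coordinates of the components of `F` of indices `K` and `K ∪ {m}`. -/
def stemSlice {n : ℕ} (F : (Fin n → ℂ) → StemSpace n) (z : Fin n → ℂ) (m : Fin n)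
    (K : Finset (Fin n)) (i : Fin 4) (w : ℂ) : ℂ :=
  ⟨coordCLM i (F (Function.update z m w) K),
    coordCLM i (F (Function.update z m w) (insert m K))⟩

section StemSlice

variable {n : ℕ} {D : Set (Fin n → ℂ)} {F : (Fin n → ℂ) → StemSpace n} {z : Fin n → ℂ}
  {m : Fin n} {K : Finset (Fin n)}

lemma conjAt_update (z : Fin n → ℂ) (m : Fin n) (w : ℂ) :
    conjAt m (Function.update z m w) = Function.update z m (starRingEnd ℂ w) := by
  simp [conjAt]

lemma stemSlice_conj (hF : IsStem D F) (hm : m ∉ K) (i : Fin 4) {w : ℂ}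
    (hw : Function.update z m w ∈ D) :
    stemSlice F z m K i (starRingEnd ℂ w) = starRingEnd ℂ (stemSlice F z m K i w) := by
  have e3 : K ∩ {m} = ∅ := Finset.inter_singleton_of_notMem hm
  have e4 : insert m K ∩ {m} = {m} := Finset.inter_singleton_of_mem (Finset.mem_insert_self m K)
  have h1 := hF.2 _ hw K m
  have h2 := hF.2 _ hw (insert m K) m
  rw [conjAt_update, e3] at h1
  rw [conjAt_update, e4] at h2
  simp [stemSlice, Complex.ext_iff, h1, h2]

lemma differentiableAt_stemSlice {w : ℂ} (hF : DifferentiableAt ℝ F (Function.update z m w))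
    (h : stemDbar m F (Function.update z m w) = 0) (hm : m ∉ K) (i : Fin 4) :
    DifferentiableAt ℂ (stemSlice F z m K i) w := by
  let T : StemSpace n →L[ℝ] ℂ :=
    Complex.ofRealCLM.comp ((coordCLM i).comp (ContinuousLinearMap.proj K)) +
      Complex.I • Complex.ofRealCLM.comp
        ((coordCLM i).comp (ContinuousLinearMap.proj (insert m K)))
  have hT (v : StemSpace n) :
      T v = (coordCLM i (v K) : ℂ) + Complex.I * (coordCLM i (v (insert m K)) : ℂ) := rfl
  have hφ : stemSlice F z m K i = fun w => T (F (Function.update z m w)) := by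
    ext w; simp [stemSlice, hT, Complex.ext_iff]
  have hu : HasFDerivAt (Function.update z m)
      (ContinuousLinearMap.single ℝ (fun _ : Fin n => ℂ) m) w := by
    refine (hasFDerivAt_update (𝕜 := ℝ) z w).congr_fderiv ?_
    ext1 v
    ext1 j
    by_cases hj : j = m
    · subst hj; simp
    · simp [hj]
  have hd : HasFDerivAt (stemSlice F z m K i)
      (T.comp ((fderiv ℝ F (Function.update z m w)).comp
        (ContinuousLinearMap.single ℝ (fun _ => ℂ) m))) w := by
    rw [hφ]
    exact T.hasFDerivAt.comp w (hF.hasFDerivAt.comp w hu)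
  obtain ⟨h1, h2⟩ := cauchyRiemann_of_stemDbar_eq_zero h hm
  refine differentiableAt_complex_iff_differentiableAt_real.2 ⟨hd.differentiableAt, ?_⟩
  -- What remains is `∂φ/∂β = i ∂φ/∂α`.
  rw [hd.fderiv]
  simp only [ContinuousLinearMap.comp_apply, ContinuousLinearMap.single_apply, hT, h1, h2,
    smul_eq_mul, map_neg, Complex.ofReal_neg]
  linear_combination (coordCLM i (fderiv ℝ F (Function.update z m w)
    (Pi.single m Complex.I) K) : ℂ) * Complex.I_sq

end StemSlice

/-! ### Assembling the slice function in the variable `x_m`. -/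

lemma norm_eq_one_and_re_eq_zero {J : ℍ[ℝ]} (hJ : J ^ 2 = -1) : ‖J‖ = 1 ∧ J.re = 0 := by
  have h1 : ‖J‖ = 1 := by
    have := congrArg norm hJ
    rw [norm_pow, norm_neg, norm_one] at this
    exact (pow_eq_one_iff_of_nonneg (norm_nonneg _) two_ne_zero).1 this
  refine ⟨h1, Quaternion.sq_eq_neg_normSq.1 ?_⟩
  rw [Quaternion.normSq_eq_norm_mul_self, h1, hJ]
  simp

/-- `axial` always lands in the closed upper half plane, whereas `w` may lie below; the invariance
of `D` absorbs the conjugation. -/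
lemma axial_eq_or_eq_conj {J : ℍ[ℝ]} (hJ : J ^ 2 = -1) (w : ℂ) :
    axial ((w.re : ℍ[ℝ]) + J * (w.im : ℍ[ℝ])) = w ∨
      axial ((w.re : ℍ[ℝ]) + J * (w.im : ℍ[ℝ])) = starRingEnd ℂ w := by
  obtain ⟨h1, h2⟩ := norm_eq_one_and_re_eq_zero hJ
  have hJim : J.im = J := by
    conv_rhs => rw [← Quaternion.re_add_im J, h2]
    simp
  have him : ((w.re : ℍ[ℝ]) + J * (w.im : ℍ[ℝ])).im = w.im • J := by
    rw [← Quaternion.coe_commutes, Quaternion.coe_mul_eq_smul, Quaternion.im_add,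
      Quaternion.im_smul, hJim]
    simp
  have hre : ((w.re : ℍ[ℝ]) + J * (w.im : ℍ[ℝ])).re = w.re := by simp [h2]
  have hn : ‖((w.re : ℍ[ℝ]) + J * (w.im : ℍ[ℝ])).im‖ = |w.im| := by
    rw [him, norm_smul, h1, mul_one, Real.norm_eq_abs]
  rcases abs_choice w.im with h | h
  · left; simp only [axial, hre, hn, h]
  · right
    apply Complex.ext
    · exact hre
    · exact hn.trans h

theorem IsSliceRegular.biharmonicAt {n : ℕ} {D : Set (Fin n → ℂ)} (hD : IsOpen D)
    {f : (Fin n → ℍ[ℝ]) → ℍ[ℝ]} (hf : IsSliceRegular D f) (m : Fin n) {x : Fin n → ℍ[ℝ]}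
    (hx : x ∈ circularization D) :
    BiharmonicAt (fun q => f (Function.update x m q)) (x m) := by
  obtain ⟨F, ⟨hstem, hdiff, hdbar⟩, hind⟩ := hf
  obtain ⟨z, hz, J, hJ, rfl⟩ := hx
  set U : Set ℂ := {w | Function.update z m w ∈ D} with hUdef
  have hU : IsOpen U := hD.preimage (continuous_const.update m continuous_id)
  have hxU : axial (slicePoint J z m) ∈ U := by
    rcases axial_eq_or_eq_conj (hJ m) (z m) with h | h
    · rw [slicePoint, h]
      simpa [hUdef] using hz
    · rw [slicePoint, h]
      exact (hstem.1 z m).1 hz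
  have hsym (K : Finset (Fin n)) (hm : m ∉ K) (i : Fin 4) (w : ℂ) (hw : w ∈ U) :=
    stemSlice_conj hstem hm i hw
  have hφ (K : Finset (Fin n)) (hm : m ∉ K) (i : Fin 4) :
      DifferentiableOn ℂ (stemSlice F z m K i) U := fun w hw =>
    (differentiableAt_stemSlice ((hdiff.contDiffAt (hD.mem_nhds hw)).differentiableAt one_ne_zero)
      (hdbar m _ hw) hm i).differentiableWithinAt
  have hAB (K : Finset (Fin n)) : ∃ A B : ℍ[ℝ], m ∉ K → ∀ a,
      orderedProd (Function.update J m a) K = A * B ∧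
        orderedProd (Function.update J m a) (insert m K) = A * a * B := by
    by_cases hm : m ∈ K
    · exact ⟨0, 0, fun h => absurd hm h⟩
    · obtain ⟨A, B, h⟩ := exists_orderedProd_update J hm
      exact ⟨A, B, fun _ => h⟩
  choose A B hAB using hAB
  let S := (Finset.univ.erase m).powerset
  have hS {K : Finset (Fin n)} (hK : K ∈ S) : m ∉ K := fun h => by
    simpa using Finset.mem_powerset.1 hK h
  -- The map `v ↦ A_K v B_K e_i`.
  let L (K : Finset (Fin n)) (i : Fin 4) : ℍ[ℝ] →L[ℝ] ℍ[ℝ] :=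
    (ContinuousLinearMap.mul ℝ ℍ[ℝ] (A K)).comp
      ((ContinuousLinearMap.mul ℝ ℍ[ℝ]).flip (B K * quaternionBasis i))
  have hbih : BiharmonicAt (∑ K ∈ S, ∑ i, L K i ∘ sliceLift (stemSlice F z m K i))
      (slicePoint J z m) :=
    BiharmonicAt.sum _ fun K hK => BiharmonicAt.sum _ fun i _ =>
      (biharmonicAt_sliceLift hU (hφ K (hS hK) i) (hsym K (hS hK) i) hxU).clm_comp _
  refine hbih.congr ?_
  filter_upwards [continuous_axial.continuousAt.eventually (hU.mem_nhds hxU)] with q hq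
  obtain ⟨a, ha, hqa⟩ := exists_imaginaryUnit q
  have hpt : Function.update (slicePoint J z) m q =
      slicePoint (Function.update J m a) (Function.update z m (axial q)) := by
    ext1 h
    by_cases hh : h = m
    · subst hh
      simp only [slicePoint, Function.update_self, axial]
      rw [← hqa, Quaternion.re_add_im]
    · simp [slicePoint, hh]
  have hunit : IsUnitTuple (Function.update J m a) := fun h => by
    by_cases hh : h = m
    · subst hh; simpa using ha
    · simpa [hh] using hJ h
  -- The subsets of indices are paired as `K`, `K ∪ {m}` with `m ∉ K`.
  rw [hpt, hind _ hq _ hunit, ← Finset.powerset_univ,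
    ← Finset.insert_erase (Finset.mem_univ m), Finset.sum_powerset_insert (by simp),
    ← Finset.sum_add_distrib]
  simp only [Finset.sum_apply]
  refine Finset.sum_congr rfl fun K hK => ?_
  obtain ⟨h1, h2⟩ := hAB K (hS hK) a
  have hreal (i : Fin 4) (h0 : q.im = 0) : (stemSlice F z m K i (axial q)).im = 0 := by
    have hs := hsym K (hS hK) i _ hq
    rw [show starRingEnd ℂ (axial q) = axial q by simp [Complex.ext_iff, axial, h0]] at hs
    exact Complex.conj_eq_iff_im.1 hs.symm
  -- The real coordinates commute with everything, so they can move next to `a`, while the basis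
  -- quaternion stays at the far right.
  have hrepr (v : ℍ[ℝ]) : v = ∑ i, (coordCLM i v : ℍ[ℝ]) * quaternionBasis i := by
    conv_lhs => rw [← quaternionBasis.sum_repr' v]
    simp [coordCLM, innerSL_apply_apply, Quaternion.coe_mul_eq_smul]
  rw [h1, h2, hrepr (F _ K), hrepr (F _ (insert m K)), Finset.mul_sum, Finset.mul_sum,
    ← Finset.sum_add_distrib]
  refine Finset.sum_congr rfl fun i _ => ?_
  change A K * (sliceLift (stemSlice F z m K i) q * (B K * quaternionBasis i)) = _
  rw [sliceLift_eq hqa (hreal i)]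
  simp only [stemSlice]
  generalize coordCLM i (F (Function.update z m (axial q)) K) = u
  generalize coordCLM i (F (Function.update z m (axial q)) (insert m K)) = v
  simp only [Quaternion.coe_mul_eq_smul, ← Quaternion.coe_commutes, add_mul, mul_add,
    smul_mul_assoc, mul_smul_comm, mul_assoc]

end SliceSeveral
end

/-- Every slice regular function is separately biharmonic in each variable. -/
theorem corollary4p7 {n : ℕ} (D : Set (Fin n → ℂ)) (hD : IsOpen D)
    (f : (Fin n → ℍ[ℝ]) → ℍ[ℝ]) (hf : SliceSeveral.IsSliceRegular D f) :
    SliceSeveral.IsSeparatelyBiharmonicOn f (SliceSeveral.circularization D) := by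
  intro m x hx
  have h := hf.biharmonicAt hD m hx
  refine ⟨h.1.contDiffAt, ?_⟩
  have h2 := h.2
  -- Successive updates of the same coordinate collapse, so `Δ_m (Δ_m f)` is the one-variable
  -- bilaplacian with the other coordinates frozen.
  simp only [SliceSeveral.partialLaplacian, Function.update_idem, Function.update_self]
  exact h2
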